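/- Let $k\ge 4$. For every integer $n>k$ let $\xi(k;n)\in(0,1)$ be an arbitrary solution of $$\Bigl(1+\tfrac{x^{n-1}}2\Bigr)^{k+1}-\Bigl(1-\tfrac{x^{n-1}}2\Bigr)^{k+1}=(k+1)\,x^{\,n-k},$$ and put $$C_n(k)=\frac{\xi(k;n)^{3n-k-2}}{\frac1{k+2}\Bigl[\bigl(1+\frac{\xi(k;n)^{n-1}}2\bigr)^{k+2}-\bigl(1-\frac{\xi(k;n)^{n-1}}2\bigr)^{k+2}\Bigr]-\xi(k;n)^{n-k}} .$$ Let $(n_p)_p$ be a strictly increasing sequence of integers $>k$ with $\lim_{p\to\infty}\xi(k;n_p)^{n_p-1}=\limsup_{n\to\infty}\xi(k;n)^{n-1}$. Put $\gamma_p(k)=C_{n_p}(k)$ and $\mathbb N_0(k)=\{p:|\gamma_p(k)|<4\}$, and for $p\in\mathbb N_0(k)$ let $$K_p(t,u;k)=1+\gamma_p(k)\bigl(t-\tfrac12\bigr)\bigl(u-\tfrac12\bigr),\qquad t,u\in[0,1].$$ Let $\Gamma^k=(V,L)$ be the Cayley tree of order $k$, i.e. the tree in which every vertex has exactly $k+1$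 neighbours, let $\beta>0$, and consider on $[0,1]^V$ the Hamiltonian $$H(\sigma)=-\frac1\beta\sum_{\langle x,y\rangle\in L}\ln K_p(\sigma(x),\sigma(y);k),$$ with Lebesgue measure on $[0,1]$ as a priori measure. A Gibbs measure for this model is a probability measure $\mu$ on $[0,1]^V$ (with the product $\sigma$-algebra) that satisfies the DLR equations: for every finite $\Lambda\subset V$, $\mu=\int\mu(d\omega)\,\gamma_\Lambda(\cdot\mid\omega)$, where under $\gamma_\Lambda(\cdot\mid\omega)$ the configuration equals $\omega$ outside $\Lambda$ and its restriction to $\Lambda$ has, with respect to $|\Lambda|$-dimensional Lebesgue measure on $[0,1]^\Lambda$, density proportional to $\exp(-\beta H_\Lambda)$, with $H_\Lambda$ the part of the sum $H$ over the edges having at least one endpoint in $\Lambda$. Then for every $p\in\mathbb N_0(k)$ this model has at least two distinct translation-invariant Gibbs measures; translation invariance is meant in the strong sense of invariance under all automorphisms of the tree (in particular under all its translations). -/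

import Mathlib

open MeasureTheory Filter Topology
open scoped ENNReal

noncomputable section

namespace CayleyGibbs

/-! ### Nearest-neighbour models with spin space `[0,1]` on a locally finite graph -/

section Model

variable {V : Type*} [DecidableEq V] (G : SimpleGraph V) [G.LocallyFinite]

/-- The a priori measure on configurations in the finite volume `Λ`: the `|Λ|`-fold product of
Lebesgue measure on `[0,1]`. -/
def apriori (Λ : Finset V) : Measure (Λ → unitInterval) :=
  Measure.pi fun _ => (volume : Measure unitInterval)

/-- The configuration on all of `V` that equals `s` on `Λ` and `ω` outside `Λ`. -/
def glue (Λ : Finset V) (s : Λ → unitInterval) (ω : V → unitInterval) : V → unitInterval :=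
  fun x => if h : x ∈ Λ then s ⟨x, h⟩ else ω x

/-- The edges having at least one endpoint in `Λ`. -/
def edgesMeeting (Λ : Finset V) : Finset (Sym2 V) :=
  Λ.biUnion fun x => G.incidenceFinset x

/-- The energy in `Λ` of a configuration `σ`, for the formal Hamiltonian
`H(σ) = ∑_{⟨x,y⟩} Φ(σ(x), σ(y))` (a sum over unordered edges, with `Φ` a symmetric function):
the sum over the edges inside `Λ` and the edges that join `Λ` to its complement. -/
def energy (Φ : Sym2 unitInterval → ℝ) (Λ : Finset V) (σ : V → unitInterval) : ℝ :=
  ∑ e ∈ edgesMeeting G Λ, Φ (e.map σ)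

/-- The Boltzmann weight `exp(-β H(s ‖ ω))` of `s` in `Λ` with boundary condition `ω`. -/
def weight (β : ℝ) (Φ : Sym2 unitInterval → ℝ) (Λ : Finset V) (ω : V → unitInterval)
    (s : Λ → unitInterval) : ℝ≥0∞ :=
  ENNReal.ofReal (Real.exp (-β * energy G Φ Λ (glue Λ s ω)))

/-- The partition function in `Λ` with boundary condition `ω`. -/
def partitionFunction (β : ℝ) (Φ : Sym2 unitInterval → ℝ) (Λ : Finset V)
    (ω : V → unitInterval) : ℝ≥0∞ :=
  ∫⁻ s, weight G β Φ Λ ω s ∂(apriori Λ)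

/-- The conditional Gibbs distribution in `Λ` given `ω` outside `Λ`, as a measure on all
configurations: inside `Λ` it has density `Z⁻¹ exp(-β H(s ‖ ω))` with respect to the a priori
measure, and outside `Λ` the configuration is frozen to `ω`. -/
def gibbsDist (β : ℝ) (Φ : Sym2 unitInterval → ℝ) (Λ : Finset V) (ω : V → unitInterval) :
    Measure (V → unitInterval) :=
  ((apriori Λ).withDensity fun s => (partitionFunction G β Φ Λ ω)⁻¹ * weight G β Φ Λ ω s).map
    fun s => glue Λ s ω

/-- `μ` is a Gibbs measure at inverse temperature `β` for the Hamiltonian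
`H(σ) = ∑_{⟨x,y⟩} Φ(σ(x), σ(y))`: a probability measure on `[0,1]^V` satisfying the DLR equation
`μ(A) = ∫ μ(dω) γ_Λ(A | ω)` in every finite volume `Λ`. -/
structure IsGibbsMeasure (β : ℝ) (Φ : Sym2 unitInterval → ℝ) (μ : Measure (V → unitInterval)) :
    Prop where
  isProbabilityMeasure : IsProbabilityMeasure μ
  dlr : ∀ (Λ : Finset V) (A : Set (V → unitInterval)), MeasurableSet A →
    μ A = ∫⁻ ω, gibbsDist G β Φ Λ ω A ∂μ

end Model

/-- Translation invariance of a measure on configurations on a regular tree, in the strongest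
sense: invariance under the shift `σ ↦ σ ∘ g` by every graph automorphism `g`. This contains
invariance under the left translations for any identification of the tree with a Cayley graph,
such as that of the free product of `k + 1` cyclic groups of order two. -/
def IsTranslationInvariant {V : Type*} (G : SimpleGraph V) (μ : Measure (V → unitInterval)) :
    Prop :=
  ∀ g : G ≃g G, μ.map (fun (σ : V → unitInterval) (x : V) => σ (g x)) = μ

/-! ### The kernels -/

/-- `P_{n,k}(x) = (1 + x^{n-1}/2)^{k+1} - (1 - x^{n-1}/2)^{k+1}`, used for `n ≥ 1`. -/
def P (k n : ℕ) (x : ℝ) : ℝ :=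
  (1 + x ^ (n - 1) / 2) ^ (k + 1) - (1 - x ^ (n - 1) / 2) ^ (k + 1)

/-- `Q_{n,k}(x) = (k+1) x^{n-k}`, used for `n > k`. -/
def Q (k n : ℕ) (x : ℝ) : ℝ :=
  ((k : ℝ) + 1) * x ^ (n - k)

/-- The number `C_n(k)` computed from the value `x = ξ(k;n)`, used for `n > k ≥ 2`, where the
truncated differences in the exponents are true differences. -/
def C (k n : ℕ) (x : ℝ) : ℝ :=
  x ^ (3 * n - k - 2) /
    (1 / (2 + (k : ℝ)) * ((1 + x ^ (n - 1) / 2) ^ (k + 2) - (1 - x ^ (n - 1) / 2) ^ (k + 2))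
      - x ^ (n - k))

/-- `ξ` chooses, for every `n > k`, some solution `ξ n ∈ (0,1)` of `P_{n,k}(x) = Q_{n,k}(x)`. -/
def IsRootSequence (k : ℕ) (ξ : ℕ → ℝ) : Prop :=
  ∀ n, k < n → ξ n ∈ Set.Ioo (0 : ℝ) 1 ∧ P k n (ξ n) = Q k n (ξ n)

/-- `n` enumerates indices `k < n 0 < n 1 < …` along which `ξ(k;n)^{n-1}` converges to its
upper limit. -/
structure IsLimsupSubsequence (k : ℕ) (ξ : ℕ → ℝ) (n : ℕ → ℕ) : Prop where
  strictMono : StrictMono n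
  gt : ∀ p, k < n p
  tendsto : Tendsto (fun p => ξ (n p) ^ (n p - 1)) atTop
    (𝓝 (limsup (fun m => ξ m ^ (m - 1)) atTop))

/-- `γ_p(k) = C_{n_p}(k)`. -/
def gam (k : ℕ) (ξ : ℕ → ℝ) (n : ℕ → ℕ) (p : ℕ) : ℝ :=
  C k (n p) (ξ (n p))

/-- The set `ℕ₀(k)` of all `p` with `|γ_p(k)| < 4`. -/
def N0 (k : ℕ) (ξ : ℕ → ℝ) (n : ℕ → ℕ) : Set ℕ :=
  {p | |gam k ξ n p| < 4}

/-- `K(t,u) = 1 + γ (t - 1/2) (u - 1/2)`. -/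
def kernel (γ t u : ℝ) : ℝ :=
  1 + γ * (t - 1 / 2) * (u - 1 / 2)

/-- The pair interaction `Φ(t,u) = -(1/β) ln K(t,u)` with `K(t,u) = 1 + γ (t - 1/2) (u - 1/2)`,
as a function of the unordered pair of spins. -/
def interaction (β γ : ℝ) : Sym2 unitInterval → ℝ :=
  Sym2.lift ⟨fun t u => -(1 / β) * Real.log (kernel γ t u), fun t u => by
    simp only [kernel, mul_right_comm]⟩

end CayleyGibbs

end

/-!
Every positive continuous solution of the Hammerstein equation `∫ K(t, u) f(u) ^ k du = lam f(t)`
is the boundary law of a Gibbs measure on the `(k + 1)`-regular tree. That measure is the law of the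
tree-indexed stationary reversible Markov chain whose stationary density is proportional to
`f ^ (k + 1)` and whose transition density from `t` to `u` is `K(t, u) f(u) ^ k / (lam f(t))`. On a
finite subtree the joint density is the product of `K` over the edges divided by a product of powers
of `f`; around a finite set `Λ` of interior vertices these powers cancel, because every vertex has
degree `k + 1`, and this is the DLR equation in `Λ`. A chain given by its finite-subtree marginals is
unique, hence invariant under all automorphisms.

For `K(t, u) = 1 + γ (t - 1/2) (u - 1/2)` the constant `1` is a boundary law. The affine function
`1 + c (t - 1/2)` is one as soon as
`γ ∫ (x - 1/2) (1 + c (x - 1/2)) ^ k = c ∫ (1 + c (x - 1/2)) ^ k`, and for `c = ξ(k;n) ^ (n - 1)`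
the equation defining `ξ(k;n)` turns this into `γ = C_n(k)`. The two Gibbs measures differ since
their single-site densities do.
-/

namespace CayleyGibbs

section InfiniteProduct

variable {ι : Type*} {X : ι → Type*} [∀ i, MeasurableSpace (X i)]

theorem measurePreserving_updateFinset [DecidableEq ι] (m : ∀ i, Measure (X i))
    [∀ i, IsProbabilityMeasure (m i)] (I : Finset ι) :
    MeasurePreserving (fun p : (∀ i, X i) × (∀ i : I, X i) => Function.updateFinset p.1 I p.2)
      ((Measure.infinitePi m).prod (Measure.pi fun i : I => m i)) (Measure.infinitePi m) := by
  refine ⟨measurable_updateFinset', Measure.eq_infinitePi m fun S t ht => ?_⟩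
  have preimage_pi : (fun p : (∀ i, X i) × (∀ i : I, X i) => Function.updateFinset p.1 I p.2) ⁻¹'
      Set.pi S t = Set.pi (S \ I : Finset ι) t ×ˢ
        Set.univ.pi fun i : I => if (i : ι) ∈ S then t i else Set.univ := by
    ext ⟨x, y⟩
    simp only [Set.mem_preimage, Set.mem_pi, Set.mem_prod, Function.updateFinset, SetLike.mem_coe]
    grind
  have prod_inter : ∏ i : I, m i (if (i : ι) ∈ S then t i else Set.univ) =
      ∏ i ∈ S ∩ I, m i (t i) := by
    rw [Finset.inter_comm, ← Finset.filter_mem_eq_inter, Finset.prod_filter,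
      ← Finset.prod_attach I, Finset.univ_eq_attach]
    exact Finset.prod_congr rfl fun i _ => by split_ifs <;> simp
  rw [Measure.map_apply measurable_updateFinset' (.pi S.countable_toSet fun i _ => ht i),
    preimage_pi, Measure.prod_prod, Measure.pi_pi, Measure.infinitePi_pi m fun i _ => ht i,
    prod_inter, mul_comm, Finset.prod_inter_mul_prod_sdiff]

theorem dependsOn_lmarginal [DecidableEq ι] (m : ∀ i, Measure (X i)) (I : Finset ι) {s : Set ι}
    {f : (∀ i, X i) → ℝ≥0∞} (hf : DependsOn f s) : DependsOn (∫⋯∫⁻_I, f ∂m) s := by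
  refine fun x x' hx => lintegral_congr fun y => hf fun i hi => ?_
  simp only [Function.updateFinset, hx i hi]

theorem lintegral_lmarginal_infinitePi [DecidableEq ι] (m : ∀ i, Measure (X i))
    [∀ i, IsProbabilityMeasure (m i)] (I : Finset ι) {f : (∀ i, X i) → ℝ≥0∞}
    (hf : Measurable f) :
    ∫⁻ x, (∫⋯∫⁻_I, f ∂m) x ∂Measure.infinitePi m = ∫⁻ x, f x ∂Measure.infinitePi m := by
  rw [← (measurePreserving_updateFinset m I).lintegral_comp hf,
    lintegral_prod _ (by exact (hf.comp measurable_updateFinset').aemeasurable)]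
  rfl

/-- The identity behind the DLR equations: averaging `f` over the coordinates in `I` with the
normalized density `q` does not change its integral against `q * r`. -/
theorem lintegral_normalized_lmarginal_mul [DecidableEq ι] (m : ∀ i, Measure (X i))
    [∀ i, IsProbabilityMeasure (m i)] (I : Finset ι) {f q r : (∀ i, X i) → ℝ≥0∞}
    (hf : Measurable f) (hq : Measurable q) (hr : Measurable r)
    (hrI : DependsOn r (I : Set ι)ᶜ) (hq_zero : ∀ x, (∫⋯∫⁻_I, q ∂m) x ≠ 0)
    (hq_top : ∀ x, (∫⋯∫⁻_I, q ∂m) x ≠ ⊤) :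
    ∫⁻ x, ((∫⋯∫⁻_I, q ∂m) x)⁻¹ * (∫⋯∫⁻_I, f * q ∂m) x * (q x * r x) ∂Measure.infinitePi m =
      ∫⁻ x, f x * (q x * r x) ∂Measure.infinitePi m := by
  have hqI := hq.lmarginal m (s := I)
  have hfqI := (hf.mul hq).lmarginal m (s := I)
  rw [← lintegral_lmarginal_infinitePi m I (by fun_prop),
    ← lintegral_lmarginal_infinitePi m I (f := fun x => f x * (q x * r x)) (by fun_prop)]
  refine lintegral_congr fun x => ?_
  have hu (y : ∀ i : I, X i) (i : ι) (hi : i ∉ I) : Function.updateFinset x I y i = x i := by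
    simp [Function.updateFinset, hi]
  have hr_update (y : ∀ i : I, X i) : r (Function.updateFinset x I y) = r x := hrI (hu y)
  have hmeas := measurable_updateFinset (s := I) (x := x)
  have pull_out (F : (∀ i, X i) → ℝ≥0∞) (hF : Measurable F) :
      (∫⋯∫⁻_I, fun x => F x * r x ∂m) x = (∫⋯∫⁻_I, F ∂m) x * r x := by
    simp only [lmarginal, hr_update]
    exact lintegral_mul_const _ (hF.comp hmeas)
  calc
    _ = ((∫⋯∫⁻_I, q ∂m) x)⁻¹ * (∫⋯∫⁻_I, f * q ∂m) x * (∫⋯∫⁻_I, fun x => q x * r x ∂m) x := by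
      rw [lmarginal]
      simp only [lmarginal_congr m _ (hu _)]
      exact lintegral_const_mul _ ((hq.mul hr).comp hmeas)
    _ = (∫⋯∫⁻_I, f * q ∂m) x * r x := by
      rw [pull_out q hq, mul_comm _⁻¹, mul_assoc, ← mul_assoc _⁻¹,
        ENNReal.inv_mul_cancel (hq_zero x) (hq_top x), one_mul]
    _ = _ := by
      rw [← pull_out _ (hf.mul hq)]
      simp only [Pi.mul_apply, mul_assoc]

theorem measurePreserving_comp_equiv_infinitePi {κ E : Type*} [MeasurableSpace E]
    (m : Measure E) [IsProbabilityMeasure m] (g : κ ≃ ι) :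
    MeasurePreserving (fun (x : ι → E) j => x (g j)) (Measure.infinitePi fun _ => m)
      (Measure.infinitePi fun _ => m) := by
  refine ⟨by fun_prop, ?_⟩
  have h := Measure.infinitePi_map_piCongrLeft (fun _ : κ => m) g.symm
  convert h using 2
  funext x j
  simp [MeasurableEquiv.coe_piCongrLeft, Equiv.piCongrLeft_apply]

theorem map_restrict_eq_iff {I : Finset ι} {μ ν : Measure (∀ i, X i)} :
    μ.map I.restrict = ν.map I.restrict ↔
      ∀ f : (∀ i, X i) → ℝ≥0∞, Measurable f → DependsOn f I →
        ∫⁻ x, f x ∂μ = ∫⁻ x, f x ∂ν := by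
  classical
  have hI : Measurable (I.restrict : (∀ i, X i) → _) := Finset.measurable_restrict I
  refine ⟨fun h f hf hdep => ?_, fun h => ?_⟩
  · rcases isEmpty_or_nonempty (∀ i, X i) with _ | ⟨⟨x₀⟩⟩
    · rw [Subsingleton.elim μ ν]
    have hf₀ : Measurable fun y => f (Function.updateFinset x₀ I y) :=
      hf.comp measurable_updateFinset
    have factor : f = fun x => f (Function.updateFinset x₀ I (I.restrict x)) :=
      funext fun x => hdep fun i hi => by simp [Function.updateFinset, Finset.mem_coe.1 hi]
    rw [factor, ← lintegral_map hf₀ hI, ← lintegral_map hf₀ hI, h]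
  · ext s hs
    rw [Measure.map_apply hI hs, Measure.map_apply hI hs, ← lintegral_indicator_one (hI hs),
      ← lintegral_indicator_one (hI hs)]
    refine h _ (measurable_one.indicator (hI hs)) fun x x' hx => ?_
    exact congrArg (s.indicator fun _ => (1 : ℝ≥0∞)) (I.dependsOn_restrict hx)

theorem map_restrict_eq_of_subset {I J : Finset ι} (hIJ : I ⊆ J) {μ ν : Measure (∀ i, X i)}
    (h : μ.map J.restrict = ν.map J.restrict) : μ.map I.restrict = ν.map I.restrict := by
  rw [map_restrict_eq_iff] at h ⊢
  exact fun f hf hdep => h f hf (hdep.mono (Finset.coe_subset.2 hIJ))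

/-- A cluster point of `ν` along `l` has the required marginals. -/
theorem exists_measure_of_eventually_map_restrict_eq {α E : Type*} [Countable ι]
    [TopologicalSpace E] [CompactSpace E] [TopologicalSpace.MetrizableSpace E] [MeasurableSpace E]
    [BorelSpace E]
    {l : Filter α} [l.NeBot] (ν : α → Measure (ι → E)) [∀ a, IsProbabilityMeasure (ν a)] :
    ∃ μ : Measure (ι → E), IsProbabilityMeasure μ ∧ ∀ (I : Finset ι) (ρ : Measure (I → E)),
      (∀ᶠ a in l, (ν a).map I.restrict = ρ) → μ.map I.restrict = ρ := by
  let νp : α → ProbabilityMeasure (ι → E) := fun a => ⟨ν a, inferInstance⟩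
  let U : Ultrafilter α := Ultrafilter.of l
  let μ : ProbabilityMeasure (ι → E) := (U.map νp).lim
  refine ⟨μ, inferInstance, fun I ρ hρ => ?_⟩
  have hc : Continuous (I.restrict : (ι → E) → I → E) := Finset.continuous_restrict I
  have hlim := ((ProbabilityMeasure.continuous_map hc).tendsto μ).comp
    (show Tendsto νp U (𝓝 μ) from (U.map νp).le_nhds_lim)
  have hev : ∀ᶠ a in U, (ν a).map I.restrict = ρ := Ultrafilter.of_le l hρ
  obtain ⟨a, ha⟩ := hev.exists
  have h : μ.map hc.aemeasurable = (νp a).map hc.aemeasurable :=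
    tendsto_nhds_unique hlim (tendsto_const_nhds.congr' (hev.mono fun b hb =>
      Subtype.ext (ha.trans hb.symm)))
  exact (congrArg Subtype.val h).trans ha

end InfiniteProduct

section Graph

variable {V : Type*} {G : SimpleGraph V}

theorem exists_adj_of_ssubset {Δ Δ' : Finset V} (hne : Δ.Nonempty) (hss : Δ ⊂ Δ')
    (hΔ' : (G.induce (Δ' : Set V)).Preconnected) :
    ∃ x ∈ Δ', x ∉ Δ ∧ ∃ y ∈ Δ, G.Adj y x := by
  obtain ⟨a, ha⟩ := hne
  obtain ⟨b, hb, hbΔ⟩ := Finset.exists_of_ssubset hss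
  obtain ⟨w⟩ := hΔ' ⟨a, hss.1 ha⟩ ⟨b, hb⟩
  obtain ⟨d, -, hd₁, hd₂⟩ := w.exists_boundary_dart {v | (v : V) ∈ Δ} ha hbΔ
  exact ⟨d.snd, d.snd.2, hd₂, d.fst, hd₁, d.adj⟩

theorem eq_of_adj_of_adj (hG : G.IsAcyclic) {Δ : Set V} (hΔ : (G.induce Δ).Preconnected)
    {x y z : V} (hx : x ∉ Δ) (hy : y ∈ Δ) (hz : z ∈ Δ) (hxy : G.Adj x y) (hxz : G.Adj x z) :
    y = z := by
  classical
  obtain ⟨p, hp⟩ := (hΔ ⟨y, hy⟩ ⟨z, hz⟩).exists_isPath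
  let q : G.Walk y z := p.map (SimpleGraph.Embedding.induce Δ).toHom
  have hq : q.IsPath := hp.map Subtype.val_injective
  have hxq : x ∉ q.support := by
    intro h
    obtain ⟨v, -, hv⟩ := List.mem_map.1
      ((SimpleGraph.Walk.support_map (SimpleGraph.Embedding.induce Δ).toHom p) ▸ h)
    exact hx (hv ▸ v.2)
  have := hG.eq_penultimate_of_adj_end (hq.concat hxq hxz.symm) hxy (by simp)
  simpa using this

theorem connected_induce_singleton (x : V) :
    (G.induce (({x} : Finset V) : Set V)).Connected := by
  rw [Finset.coe_singleton]
  exact ⟨SimpleGraph.Preconnected.of_subsingleton⟩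

theorem connected_induce_insert [DecidableEq V] {Δ : Finset V} {x y : V}
    (hΔ : (G.induce (Δ : Set V)).Connected) (hy : y ∈ Δ) (hyx : G.Adj y x) :
    (G.induce ((insert x Δ : Finset V) : Set V)).Connected := by
  have := SimpleGraph.connected_induce_union (t := {x}) hΔ.preconnected
    (SimpleGraph.Preconnected.of_subsingleton) hy rfl hyx
  rwa [Set.union_singleton, ← Finset.coe_insert] at this

theorem connected_induce_map {Δ : Finset V} (hΔ : (G.induce (Δ : Set V)).Connected)
    (g : G ≃g G) : (G.induce (Δ.map g.toEquiv.toEmbedding : Set V)).Connected := by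
  refine hΔ.map (⟨fun v => ⟨g v, by simp⟩, fun h => g.map_adj_iff.2 h⟩ :
    G.induce (Δ : Set V) →g G.induce (Δ.map g.toEquiv.toEmbedding : Set V)) ?_
  rintro ⟨v, hv⟩
  obtain ⟨w, hw, rfl⟩ := Finset.mem_map.1 (Finset.mem_coe.1 hv)
  exact ⟨⟨w, hw⟩, rfl⟩

theorem exists_connected_induce_superset (hG : G.Connected) (S : Finset V) :
    ∃ T, S ⊆ T ∧ (G.induce (T : Set V)).Connected := by
  classical
  obtain ⟨o⟩ := hG.nonempty
  obtain ⟨T, hT, hc⟩ := SimpleGraph.extend_finset_to_connected hG.preconnected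
    (Finset.insert_nonempty o S)
  exact ⟨T, (Finset.subset_insert _ _).trans hT, hc⟩

theorem connected_induce_induction [DecidableEq V] {Δ Δ' : Finset V}
    (hΔ : (G.induce (Δ : Set V)).Connected) (hΔ' : (G.induce (Δ' : Set V)).Connected)
    (hsub : Δ ⊆ Δ') {motive : Finset V → Prop} (base : motive Δ)
    (step : ∀ T : Finset V, (G.induce (T : Set V)).Connected → Δ ⊆ T →
      ∀ x ∉ T, ∀ y ∈ T, G.Adj y x → motive T → motive (insert x T)) :
    motive Δ' := by
  induction hn : (Δ' \ Δ).card using Nat.strong_induction_on generalizing Δ with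
  | _ n ih =>
    rcases hsub.eq_or_ssubset with rfl | hss
    · exact base
    obtain ⟨⟨a, ha⟩⟩ := hΔ.nonempty
    obtain ⟨x, hx', hx, y, hy, hyx⟩ := exists_adj_of_ssubset ⟨a, ha⟩ hss hΔ'.preconnected
    have card_lt : (Δ' \ insert x Δ).card < n := by
      rw [← hn, Finset.sdiff_insert]
      exact Finset.card_erase_lt_of_mem (by simp [hx, hx'])
    exact ih _ card_lt (connected_induce_insert hΔ hy hyx) (Finset.insert_subset hx' hsub)
      (step Δ hΔ subset_rfl x hx y hy hyx base)
      (fun T hT hΔT => step T hT ((Finset.subset_insert _ _).trans hΔT)) rfl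

theorem countable_of_connected [G.LocallyFinite] (hG : G.Connected) : Countable V := by
  obtain ⟨o⟩ := hG.nonempty
  have finite_sphere (n : ℕ) : {v | ∃ w : G.Walk v o, w.length = n}.Finite := by
    induction n with
    | zero =>
      refine (Set.finite_singleton o).subset ?_
      rintro v ⟨w, hw⟩
      exact w.eq_of_length_eq_zero hw
    | succ n ih =>
      refine (ih.biUnion fun u _ => (G.neighborSet u).toFinite).subset ?_
      rintro v ⟨_ | ⟨h, w⟩, hw⟩
      · simp at hw
      · exact Set.mem_biUnion ⟨w, by simpa using hw⟩ h.symm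
  refine Set.countable_univ_iff.1 ((Set.countable_iUnion fun n =>
    (finite_sphere n).countable).mono fun v _ => ?_)
  obtain ⟨w⟩ := hG.preconnected v o
  exact Set.mem_iUnion.2 ⟨w.length, w, rfl⟩

theorem mem_edgesMeeting [DecidableEq V] [G.LocallyFinite] {Λ : Finset V} {e : Sym2 V} :
    e ∈ edgesMeeting G Λ ↔ e ∈ G.edgeSet ∧ ∃ x ∈ Λ, x ∈ e := by
  simp only [edgesMeeting, Finset.mem_biUnion, SimpleGraph.mem_incidenceFinset,
    SimpleGraph.incidenceSet, Set.mem_sep_iff]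
  tauto

theorem prod_mul_edgesMeeting [DecidableEq V] [G.LocallyFinite] {M : Type*} [CommMonoid M]
    (h : V → M) (Λ : Finset V) :
    ∏ e ∈ edgesMeeting G Λ, (e.map h).mul = (∏ x ∈ Λ, h x ^ G.degree x) *
      ∏ e ∈ edgesMeeting G Λ, ∏ v ∈ e.toFinset with v ∉ Λ, h v := by
  have mul_eq (e : Sym2 V) (he : e ∈ edgesMeeting G Λ) : (e.map h).mul =
      (∏ v ∈ e.toFinset with v ∈ Λ, h v) * ∏ v ∈ e.toFinset with v ∉ Λ, h v := by
    rw [Finset.prod_filter_mul_prod_filter_not]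
    have hadj := (mem_edgesMeeting.1 he).1
    induction e with
    | _ a b => rw [Sym2.toFinset_mk_eq, Finset.prod_pair hadj.ne, Sym2.map_mk, Sym2.mul_mk]
  rw [Finset.prod_congr rfl mul_eq, Finset.prod_mul_distrib]
  congr 1
  rw [Finset.prod_comm' (t' := Λ) (s' := fun v => G.incidenceFinset v)]
  · simp only [Finset.prod_const, SimpleGraph.card_incidenceFinset_eq_degree]
  · simp only [mem_edgesMeeting, Finset.mem_filter, Sym2.mem_toFinset,
      SimpleGraph.mem_incidenceFinset, SimpleGraph.incidenceSet, Set.mem_sep_iff]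
    grind

variable (G) in
open Classical in
/-- The edges having both endpoints in `Δ`. -/
noncomputable def innerEdges (Δ : Finset V) : Finset (Sym2 V) :=
  {e ∈ Δ.sym2 | e ∈ G.edgeSet}

theorem mem_innerEdges {Δ : Finset V} {e : Sym2 V} :
    e ∈ innerEdges G Δ ↔ e ∈ G.edgeSet ∧ ∀ v ∈ e, v ∈ Δ := by
  classical
  simp only [innerEdges, Finset.mem_filter, Finset.mem_sym2_iff, and_comm]

theorem exists_connected_induce_edgesMeeting_subset [DecidableEq V] [G.LocallyFinite]
    (hG : G.Connected) (S Λ : Finset V) :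
    ∃ T, S ⊆ T ∧ edgesMeeting G Λ ⊆ innerEdges G T ∧ (G.induce (T : Set V)).Connected := by
  obtain ⟨T, hST, hT⟩ := exists_connected_induce_superset hG
    (S ∪ (edgesMeeting G Λ).biUnion Sym2.toFinset)
  refine ⟨T, Finset.union_subset_left hST, fun e he => mem_innerEdges.2
    ⟨(mem_edgesMeeting.1 he).1, fun v hv => Finset.union_subset_right hST ?_⟩, hT⟩
  exact Finset.mem_biUnion.2 ⟨e, he, Sym2.mem_toFinset.2 hv⟩

theorem innerEdges_singleton (x : V) : innerEdges G {x} = ∅ := by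
  refine Finset.eq_empty_of_forall_notMem fun e he => ?_
  rw [mem_innerEdges] at he
  induction e with
  | _ a b =>
    simp only [SimpleGraph.mem_edgeSet, Sym2.mem_iff, forall_eq_or_imp, forall_eq,
      Finset.mem_singleton] at he
    exact he.1.ne (he.2.1.trans he.2.2.symm)

theorem innerEdges_insert [DecidableEq V] (hG : G.IsAcyclic) {Δ : Finset V}
    (hΔ : (G.induce (Δ : Set V)).Preconnected) {x y : V} (hx : x ∉ Δ) (hy : y ∈ Δ)
    (hyx : G.Adj y x) : innerEdges G (insert x Δ) = insert s(y, x) (innerEdges G Δ) := by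
  have huniq (z : V) (hz : z ∈ Δ) (hxz : G.Adj x z) : z = y :=
    eq_of_adj_of_adj hG hΔ hx hz hy hxz hyx.symm
  ext e
  rw [Finset.mem_insert, mem_innerEdges, mem_innerEdges]
  induction e with
  | _ a b =>
    simp only [SimpleGraph.mem_edgeSet, Sym2.mem_iff, forall_eq_or_imp, forall_eq,
      Finset.mem_insert, Sym2.eq_iff]
    constructor
    · rintro ⟨hab, rfl | ha, rfl | hb⟩
      · exact (hab.ne rfl).elim
      · exact Or.inl (Or.inr ⟨rfl, huniq b hb hab⟩)
      · exact Or.inl (Or.inl ⟨huniq a ha hab.symm, rfl⟩)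
      · exact Or.inr ⟨hab, ha, hb⟩
    · rintro ((⟨rfl, rfl⟩ | ⟨rfl, rfl⟩) | ⟨hab, ha, hb⟩)
      · exact ⟨hyx, Or.inr hy, Or.inl rfl⟩
      · exact ⟨hyx.symm, Or.inl rfl, Or.inr hy⟩
      · exact ⟨hab, Or.inr ha, Or.inr hb⟩

theorem innerEdges_map (g : G ≃g G) (Δ : Finset V) :
    innerEdges G (Δ.map g.toEquiv.toEmbedding) =
      (innerEdges G Δ).map g.toEquiv.toEmbedding.sym2Map := by
  classical
  simp only [innerEdges, Finset.sym2_map, Finset.filter_map]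
  congr! 3
  exact funext fun e => propext g.map_mem_edgeSet_iff

end Graph

section TreeChain

theorem measurable_comp_sym2Map {V E F : Type*} [MeasurableSpace E] [MeasurableSpace F]
    {Ψ : Sym2 E → F} (hΨ : Measurable fun p : E × E => Ψ s(p.1, p.2)) (e : Sym2 V) :
    Measurable fun σ : V → E => Ψ (e.map σ) := by
  induction e with
  | _ a b => exact hΨ.comp (f := fun σ : V → E => (σ a, σ b)) (by fun_prop)

variable {V E : Type*} {ρ : E → ℝ≥0∞} {Ψ : Sym2 E → ℝ≥0∞}

variable (G : SimpleGraph V)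

/-- The joint density, relative to independent spins, of the spins in `Δ` of a reversible Markov
chain indexed by the tree `G`. -/
noncomputable def treeDensity (ρ : E → ℝ≥0∞) (Ψ : Sym2 E → ℝ≥0∞) (Δ : Finset V) (σ : V → E) :
    ℝ≥0∞ :=
  (∏ x ∈ Δ, ρ (σ x)) * ∏ e ∈ innerEdges G Δ, Ψ (e.map σ)

theorem dependsOn_treeDensity (Δ : Finset V) : DependsOn (treeDensity G ρ Ψ Δ) Δ := by
  intro σ τ h
  refine congrArg₂ (· * ·) (Finset.prod_congr rfl fun x hx => by rw [h x hx])
    (Finset.prod_congr rfl fun e he => ?_)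
  rw [Sym2.map_congr fun v hv => h v ((mem_innerEdges.1 he).2 v hv)]

theorem treeDensity_comp_iso (g : G ≃g G) (Δ : Finset V) (σ : V → E) :
    treeDensity G ρ Ψ Δ (fun x => σ (g x)) =
      treeDensity G ρ Ψ (Δ.map g.toEquiv.toEmbedding) σ := by
  rw [treeDensity, treeDensity, innerEdges_map, Finset.prod_map, Finset.prod_map]
  refine congrArg _ (Finset.prod_congr rfl fun e _ => ?_)
  rw [Function.Embedding.sym2Map_apply, Sym2.map_map]
  rfl

variable {G}

theorem treeDensity_insert_update [DecidableEq V] (hG : G.IsAcyclic) {Δ : Finset V}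
    (hΔ : (G.induce (Δ : Set V)).Preconnected) {x y : V} (hx : x ∉ Δ) (hy : y ∈ Δ)
    (hyx : G.Adj y x) (σ : V → E) (u : E) :
    treeDensity G ρ Ψ (insert x Δ) (Function.update σ x u) =
      treeDensity G ρ Ψ Δ σ * (ρ u * Ψ s(σ y, u)) := by
  have not_mem : s(y, x) ∉ innerEdges G Δ := fun h =>
    hx ((mem_innerEdges.1 h).2 x (Sym2.mem_mk_right y x))
  have density_update : treeDensity G ρ Ψ Δ (Function.update σ x u) = treeDensity G ρ Ψ Δ σ :=
    dependsOn_treeDensity G Δ fun z hz =>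
      Function.update_of_ne (ne_of_mem_of_not_mem (Finset.mem_coe.1 hz) hx) _ _
  rw [← density_update, treeDensity, treeDensity, innerEdges_insert hG hΔ hx hy hyx,
    Finset.prod_insert hx, Finset.prod_insert not_mem, Sym2.map_mk, Function.update_self,
    Function.update_of_ne hyx.ne]
  ring

variable [MeasurableSpace E] {m : Measure E}

/-- The densities, relative to `m`, of a stationary reversible Markov chain: `ρ` is the density of
the stationary law and `ρ u * Ψ s(t, u)` that of the transition from `t` to `u`. -/
structure IsMarkovDensity (m : Measure E) (ρ : E → ℝ≥0∞) (Ψ : Sym2 E → ℝ≥0∞) : Prop where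
  measurable_site : Measurable ρ
  measurable_edge : Measurable fun p : E × E => Ψ s(p.1, p.2)
  lintegral_site : ∫⁻ u, ρ u ∂m = 1
  lintegral_transition : ∀ t, ∫⁻ u, ρ u * Ψ s(t, u) ∂m = 1

variable (G) in
theorem IsMarkovDensity.measurable_treeDensity (h : IsMarkovDensity m ρ Ψ) (Δ : Finset V) :
    Measurable (treeDensity G ρ Ψ Δ) :=
  (Finset.measurable_fun_prod _ fun x _ => h.measurable_site.comp (measurable_pi_apply x)).mul
    (Finset.measurable_fun_prod _ fun e _ => measurable_comp_sym2Map h.measurable_edge e)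

theorem IsMarkovDensity.exists_treeDensity_eq_mul [DecidableEq V] [G.LocallyFinite]
    (h : IsMarkovDensity m ρ Ψ) {Λ T : Finset V} (hΛT : Λ ⊆ T)
    (hedges : edgesMeeting G Λ ⊆ innerEdges G T) :
    ∃ r : (V → E) → ℝ≥0∞, Measurable r ∧ DependsOn r (Λ : Set V)ᶜ ∧ ∀ σ, treeDensity G ρ Ψ T σ =
      ((∏ x ∈ Λ, ρ (σ x)) * ∏ e ∈ edgesMeeting G Λ, Ψ (e.map σ)) * r σ := by
  refine ⟨fun σ => (∏ x ∈ T \ Λ, ρ (σ x)) *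
      ∏ e ∈ innerEdges G T \ edgesMeeting G Λ, Ψ (e.map σ), ?_, fun σ τ hστ => ?_, fun σ => ?_⟩
  · exact (Finset.measurable_fun_prod _ fun x _ =>
      h.measurable_site.comp (measurable_pi_apply x)).mul
      (Finset.measurable_fun_prod _ fun e _ => measurable_comp_sym2Map h.measurable_edge e)
  · refine congrArg₂ (· * ·) (Finset.prod_congr rfl fun x hx => ?_)
      (Finset.prod_congr rfl fun e he => ?_)
    · rw [hστ x (Finset.mem_sdiff.1 hx).2]
    · obtain ⟨he, he'⟩ := Finset.mem_sdiff.1 he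
      rw [Sym2.map_congr fun v hv => hστ v fun hvΛ =>
        he' (mem_edgesMeeting.2 ⟨(mem_innerEdges.1 he).1, v, hvΛ, hv⟩)]
  · rw [treeDensity, ← Finset.prod_sdiff hΛT, ← Finset.prod_sdiff hedges]
    ring

variable (G) in
/-- The law of spins whose density relative to independent spins of law `m` is
`treeDensity G ρ Ψ Δ`; only its marginal on `Δ` is meaningful. -/
noncomputable def treeMeasure (m : Measure E) (ρ : E → ℝ≥0∞) (Ψ : Sym2 E → ℝ≥0∞)
    (Δ : Finset V) : Measure (V → E) :=
  (Measure.infinitePi fun _ => m).withDensity (treeDensity G ρ Ψ Δ)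

theorem IsMarkovDensity.lintegral_treeMeasure (h : IsMarkovDensity m ρ Ψ) (Δ : Finset V)
    {f : (V → E) → ℝ≥0∞} (hf : Measurable f) :
    ∫⁻ σ, f σ ∂treeMeasure G m ρ Ψ Δ =
      ∫⁻ σ, f σ * treeDensity G ρ Ψ Δ σ ∂Measure.infinitePi fun _ => m := by
  rw [treeMeasure, lintegral_withDensity_eq_lintegral_mul _ (h.measurable_treeDensity G Δ) hf]
  simp only [Pi.mul_apply, mul_comm]

variable (G) in
/-- `μ` is the law of the reversible Markov chain indexed by the tree `G` with densities `ρ`, `Ψ`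
relative to `m`. -/
def IsTreeChain (m : Measure E) (ρ : E → ℝ≥0∞) (Ψ : Sym2 E → ℝ≥0∞)
    (μ : Measure (V → E)) : Prop :=
  ∀ Δ : Finset V, (G.induce (Δ : Set V)).Connected →
    μ.map Δ.restrict = (treeMeasure G m ρ Ψ Δ).map Δ.restrict

variable {μ ν : Measure (V → E)}

theorem IsTreeChain.lintegral_eq (hμ : IsTreeChain G m ρ Ψ μ) (h : IsMarkovDensity m ρ Ψ)
    {Δ : Finset V} (hΔ : (G.induce (Δ : Set V)).Connected) {f : (V → E) → ℝ≥0∞} (hf : Measurable f)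
    (hdep : DependsOn f Δ) :
    ∫⁻ σ, f σ ∂μ = ∫⁻ σ, f σ * treeDensity G ρ Ψ Δ σ ∂Measure.infinitePi fun _ => m :=
  (map_restrict_eq_iff.1 (hμ Δ hΔ) f hf hdep).trans (h.lintegral_treeMeasure Δ hf)

theorem IsTreeChain.unique [IsFiniteMeasure ν] (hG : G.Connected) (hμ : IsTreeChain G m ρ Ψ μ)
    (hν : IsTreeChain G m ρ Ψ ν) : μ = ν := by
  refine IsProjectiveLimit.unique (P := fun I => ν.map I.restrict) (fun I => ?_) fun I => rfl
  obtain ⟨T, hIT, hT⟩ := exists_connected_induce_superset hG I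
  exact map_restrict_eq_of_subset hIT ((hμ T hT).trans (hν T hT).symm)

variable [IsProbabilityMeasure m]

theorem IsMarkovDensity.map_restrict_treeMeasure_insert [DecidableEq V]
    (h : IsMarkovDensity m ρ Ψ) (hG : G.IsAcyclic) {Δ : Finset V}
    (hΔ : (G.induce (Δ : Set V)).Preconnected) {x y : V} (hx : x ∉ Δ) (hy : y ∈ Δ)
    (hyx : G.Adj y x) :
    (treeMeasure G m ρ Ψ (insert x Δ)).map Δ.restrict =
      (treeMeasure G m ρ Ψ Δ).map Δ.restrict := by
  refine map_restrict_eq_iff.2 fun f hf hdep => ?_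
  have hfd := hf.mul (h.measurable_treeDensity G (insert x Δ))
  rw [h.lintegral_treeMeasure _ hf, h.lintegral_treeMeasure _ hf,
    ← lintegral_lmarginal_infinitePi _ {x} (by exact hfd)]
  refine lintegral_congr fun σ => ?_
  have f_update (u : E) : f (Function.update σ x u) = f σ := hdep fun z hz =>
    Function.update_of_ne (ne_of_mem_of_not_mem (Finset.mem_coe.1 hz) hx) _ _
  have htrans : Measurable fun u => ρ u * Ψ s(σ y, u) :=
    h.measurable_site.mul (h.measurable_edge.comp measurable_prodMk_left)
  simp only [lmarginal_singleton, f_update, treeDensity_insert_update hG hΔ hx hy hyx]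
  rw [lintegral_const_mul _ (htrans.const_mul _), lintegral_const_mul _ htrans,
    h.lintegral_transition, mul_one]

theorem IsMarkovDensity.map_restrict_treeMeasure_of_subset (h : IsMarkovDensity m ρ Ψ)
    (hG : G.IsAcyclic) {Δ Δ' : Finset V} (hΔ : (G.induce (Δ : Set V)).Connected)
    (hΔ' : (G.induce (Δ' : Set V)).Connected) (hsub : Δ ⊆ Δ') :
    (treeMeasure G m ρ Ψ Δ').map Δ.restrict = (treeMeasure G m ρ Ψ Δ).map Δ.restrict := by
  classical
  refine connected_induce_induction (motive := fun T =>
    (treeMeasure G m ρ Ψ T).map Δ.restrict = (treeMeasure G m ρ Ψ Δ).map Δ.restrict)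
    hΔ hΔ' hsub rfl fun T hT hΔT x hx y hy hyx ih => ?_
  exact (map_restrict_eq_of_subset hΔT
    (h.map_restrict_treeMeasure_insert hG hT.preconnected hx hy hyx)).trans ih

theorem IsMarkovDensity.map_eval_treeMeasure_singleton (h : IsMarkovDensity m ρ Ψ) (x : V) :
    (treeMeasure G m ρ Ψ {x}).map (Function.eval x) = m.withDensity ρ := by
  refine Measure.ext_of_lintegral _ fun f hf => ?_
  rw [lintegral_map hf (measurable_pi_apply x),
    h.lintegral_treeMeasure _ (f := fun σ => f (σ x)) (hf.comp (measurable_pi_apply x)),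
    lintegral_withDensity_eq_lintegral_mul _ h.measurable_site hf,
    ← (measurePreserving_eval_infinitePi (fun _ : V => m) x).lintegral_comp
      (h.measurable_site.mul hf)]
  simp only [treeDensity, innerEdges_singleton, Finset.prod_singleton, Finset.prod_empty, mul_one,
    Pi.mul_apply, Function.eval, mul_comm]

theorem IsMarkovDensity.isProbabilityMeasure_treeMeasure (h : IsMarkovDensity m ρ Ψ)
    (hG : G.IsAcyclic) {Δ : Finset V} (hΔ : (G.induce (Δ : Set V)).Connected) :
    IsProbabilityMeasure (treeMeasure G m ρ Ψ Δ) := by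
  obtain ⟨⟨x, hx⟩⟩ := hΔ.nonempty
  have mass_eq := congrArg (· Set.univ) (h.map_restrict_treeMeasure_of_subset hG
    (connected_induce_singleton x) hΔ (Finset.singleton_subset_iff.2 hx))
  have mass_singleton := congrArg (· Set.univ) (h.map_eval_treeMeasure_singleton (G := G) x)
  simp only [Measure.map_apply (Finset.measurable_restrict _) .univ,
    Measure.map_apply (measurable_pi_apply x) .univ, withDensity_apply _ MeasurableSet.univ,
    Set.preimage_univ, Measure.restrict_univ, h.lintegral_site] at mass_eq mass_singleton
  exact ⟨mass_eq.trans mass_singleton⟩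

theorem exists_isTreeChain [G.LocallyFinite] [TopologicalSpace E] [CompactSpace E]
    [TopologicalSpace.MetrizableSpace E] [BorelSpace E] (hG : G.IsTree)
    (h : IsMarkovDensity m ρ Ψ) :
    ∃ μ : Measure (V → E), IsProbabilityMeasure μ ∧ IsTreeChain G m ρ Ψ μ := by
  have : Countable V := countable_of_connected hG.connected
  choose T hST hT using exists_connected_induce_superset hG.connected
  have (S : Finset V) := h.isProbabilityMeasure_treeMeasure hG.isAcyclic (hT S)
  obtain ⟨μ, hμ, hmarg⟩ := exists_measure_of_eventually_map_restrict_eq (l := atTop)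
    fun S => treeMeasure G m ρ Ψ (T S)
  refine ⟨μ, hμ, fun Δ hΔ => hmarg Δ _ ?_⟩
  filter_upwards [eventually_ge_atTop Δ] with S hΔS
  exact h.map_restrict_treeMeasure_of_subset hG.isAcyclic hΔ (hT S) (hΔS.trans (hST S))

theorem IsTreeChain.map_eval (hμ : IsTreeChain G m ρ Ψ μ) (h : IsMarkovDensity m ρ Ψ) (x : V) :
    μ.map (Function.eval x) = m.withDensity ρ := by
  rw [← h.map_eval_treeMeasure_singleton (G := G) x]
  have hx : Measurable fun s : ({x} : Finset V) → E => s ⟨x, Finset.mem_singleton_self x⟩ :=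
    measurable_pi_apply _
  have := congrArg (Measure.map fun s => s ⟨x, Finset.mem_singleton_self x⟩)
    (hμ {x} (connected_induce_singleton x))
  rwa [Measure.map_map hx (Finset.measurable_restrict _),
    Measure.map_map hx (Finset.measurable_restrict _)] at this

theorem IsTreeChain.map_iso (hμ : IsTreeChain G m ρ Ψ μ) (h : IsMarkovDensity m ρ Ψ)
    (g : G ≃g G) :
    IsTreeChain G m ρ Ψ (μ.map fun (σ : V → E) x => σ (g x)) := by
  refine fun Δ hΔ => map_restrict_eq_iff.2 fun f hf hdep => ?_
  have hg : Measurable fun (σ : V → E) x => σ (g x) := by fun_prop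
  rw [lintegral_map hf hg, h.lintegral_treeMeasure Δ hf,
    hμ.lintegral_eq h (connected_induce_map hΔ g) (f := fun σ => f fun x => σ (g x)) (hf.comp hg)
      fun σ τ hστ => hdep fun x hx => hστ (g x) (by simpa using hx),
    ← (measurePreserving_comp_equiv_infinitePi m g.toEquiv).lintegral_comp
      (f := fun σ => f σ * treeDensity G ρ Ψ Δ σ) (hf.mul (h.measurable_treeDensity G Δ))]
  exact lintegral_congr fun σ => congrArg _ (treeDensity_comp_iso G g Δ σ).symm

end TreeChain

section DLR

variable {V : Type*} [DecidableEq V] {G : SimpleGraph V} [G.LocallyFinite] {β : ℝ}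
  {Φ : Sym2 unitInterval → ℝ}

variable (G β Φ) in
/-- The Boltzmann factor `exp(-β H_Λ(σ))` as a function of the whole configuration. With it,
`weight G β Φ Λ ω s` is the value at `Function.updateFinset ω Λ s`, so that conditional Gibbs
distributions become marginal integrals. -/
noncomputable def boltzmann (Λ : Finset V) (σ : V → unitInterval) : ℝ≥0∞ :=
  ENNReal.ofReal (Real.exp (-β * energy G Φ Λ σ))

theorem dependsOn_boltzmann {Λ T : Finset V} (hT : edgesMeeting G Λ ⊆ innerEdges G T) :
    DependsOn (boltzmann G β Φ Λ) T := by
  refine fun σ τ h => congrArg (fun H => ENNReal.ofReal (Real.exp (-β * H))) ?_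
  refine Finset.sum_congr rfl fun e he => ?_
  rw [Sym2.map_congr fun v hv => h v ((mem_innerEdges.1 (hT he)).2 v hv)]

variable (hΦ : Continuous fun p : unitInterval × unitInterval => Φ s(p.1, p.2))
include hΦ

theorem continuous_energy (Λ : Finset V) : Continuous (energy G Φ Λ) := by
  refine continuous_finsetSum _ fun e _ => ?_
  induction e with
  | _ a b => exact hΦ.comp (f := fun σ : V → unitInterval => (σ a, σ b)) (by fun_prop)

theorem measurable_boltzmann (Λ : Finset V) : Measurable (boltzmann G β Φ Λ) :=
  ((Finset.measurable_fun_sum _ fun e _ =>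
    measurable_comp_sym2Map hΦ.measurable e).const_mul _).exp.ennreal_ofReal

theorem lmarginal_boltzmann_ne_zero (Λ : Finset V) (ω : V → unitInterval) :
    (∫⋯∫⁻_Λ, boltzmann G β Φ Λ ∂fun _ => volume) ω ≠ 0 := by
  have hmeas := (measurable_boltzmann (β := β) (G := G) hΦ Λ).comp
    (measurable_updateFinset (x := ω) (s := Λ))
  intro h
  obtain ⟨s, hs⟩ := ((lintegral_eq_zero_iff hmeas).1 h).exists
  exact (ENNReal.ofReal_pos.2 (Real.exp_pos _)).ne' hs

theorem lmarginal_boltzmann_ne_top (Λ : Finset V) (ω : V → unitInterval) :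
    (∫⋯∫⁻_Λ, boltzmann G β Φ Λ ∂fun _ => volume) ω ≠ ⊤ := by
  have hcont : Continuous fun s : Λ → unitInterval =>
      Real.exp (-β * energy G Φ Λ (Function.updateFinset ω Λ s)) := by
    have hupdate : Continuous fun s : Λ → unitInterval => Function.updateFinset ω Λ s :=
      continuous_pi fun x => by unfold Function.updateFinset; split_ifs <;> fun_prop
    exact (((continuous_energy hΦ Λ).comp hupdate).const_mul _).rexp
  exact (hcont.integrable_of_hasCompactSupport (.of_compactSpace _)).lintegral_lt_top.ne

theorem lintegral_gibbsDist (Λ : Finset V) (ω : V → unitInterval)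
    {f : (V → unitInterval) → ℝ≥0∞} (hf : Measurable f) :
    ∫⁻ σ, f σ ∂gibbsDist G β Φ Λ ω =
      ((∫⋯∫⁻_Λ, boltzmann G β Φ Λ ∂fun _ => volume) ω)⁻¹ *
        (∫⋯∫⁻_Λ, f * boltzmann G β Φ Λ ∂fun _ => volume) ω := by
  have hω : Measurable fun s : Λ → unitInterval => glue Λ s ω := measurable_updateFinset
  have hweight : Measurable (weight G β Φ Λ ω) := (measurable_boltzmann hΦ Λ).comp hω
  rw [gibbsDist, lintegral_map hf hω,
    lintegral_withDensity_eq_lintegral_mul _ (hweight.const_mul _)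
      (g := fun s => f (glue Λ s ω)) (hf.comp hω)]
  simp only [Pi.mul_apply, mul_assoc, mul_comm (weight G β Φ Λ ω _)]
  exact lintegral_const_mul _ ((hf.comp hω).mul hweight)

theorem measurable_gibbsDist (Λ : Finset V) : Measurable (gibbsDist G β Φ Λ) := by
  refine Measure.measurable_of_measurable_coe _ fun A hA => ?_
  have hind : Measurable (A.indicator (1 : (V → unitInterval) → ℝ≥0∞)) :=
    measurable_one.indicator hA
  have hboltz := measurable_boltzmann (G := G) (β := β) hΦ Λ
  simp only [← lintegral_indicator_one hA, lintegral_gibbsDist hΦ Λ _ hind]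
  exact (hboltz.lmarginal _).inv.mul ((hind.mul hboltz).lmarginal _)

theorem IsTreeChain.isGibbsMeasure {ρ : unitInterval → ℝ≥0∞} {Ψ : Sym2 unitInterval → ℝ≥0∞}
    {μ : Measure (V → unitInterval)} [IsProbabilityMeasure μ] (hμ : IsTreeChain G volume ρ Ψ μ)
    (h : IsMarkovDensity volume ρ Ψ) (hG : G.Connected)
    (hlocal : ∀ Λ : Finset V, ∃ r : (V → unitInterval) → ℝ≥0∞, Measurable r ∧
      DependsOn r (Λ : Set V)ᶜ ∧ ∀ σ, (∏ x ∈ Λ, ρ (σ x)) * ∏ e ∈ edgesMeeting G Λ, Ψ (e.map σ) =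
        boltzmann G β Φ Λ σ * r σ) :
    IsGibbsMeasure G β Φ μ := by
  refine ⟨inferInstance, fun Λ A hA => ?_⟩
  have hkernel := measurable_gibbsDist (G := G) (β := β) hΦ Λ
  suffices μ.bind (gibbsDist G β Φ Λ) = μ by
    rw [← Measure.bind_apply hA hkernel.aemeasurable, this]
  refine IsProjectiveLimit.unique (P := fun Δ => μ.map Δ.restrict) (fun Δ => ?_) fun Δ => rfl
  refine map_restrict_eq_iff.2 fun f hf hdep => ?_
  obtain ⟨T, hT, hΛT, hTc⟩ := exists_connected_induce_edgesMeeting_subset hG (Δ ∪ Λ) Λ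
  obtain ⟨r₁, hr₁, hrΛ₁, hinside⟩ := hlocal Λ
  obtain ⟨r₂, hr₂, hrΛ₂, houtside⟩ :=
    h.exists_treeDensity_eq_mul (Finset.union_subset_right hT) hΛT
  have hfT : DependsOn f T := hdep.mono (Finset.coe_subset.2 (Finset.union_subset_left hT))
  have hb := measurable_boltzmann (G := G) (β := β) hΦ Λ
  have hbT := dependsOn_boltzmann (β := β) (Φ := Φ) hΛT
  have hfbT : DependsOn (f * boltzmann G β Φ Λ) T := fun σ τ hστ =>
    congrArg₂ (· * ·) (hfT hστ) (hbT hστ)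
  have hcond : Measurable fun ω => ((∫⋯∫⁻_Λ, boltzmann G β Φ Λ ∂fun _ => volume) ω)⁻¹ *
      (∫⋯∫⁻_Λ, f * boltzmann G β Φ Λ ∂fun _ => volume) ω :=
    (hb.lmarginal _).inv.mul ((hf.mul hb).lmarginal _)
  rw [Measure.lintegral_bind hkernel.aemeasurable hf.aemeasurable]
  simp only [lintegral_gibbsDist hΦ Λ _ hf]
  rw [hμ.lintegral_eq h hTc hf hfT, hμ.lintegral_eq h hTc hcond fun σ τ hστ =>
    congrArg₂ (fun a b => a⁻¹ * b) (dependsOn_lmarginal _ Λ hbT hστ)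
      (dependsOn_lmarginal _ Λ hfbT hστ)]
  simp only [houtside, hinside, mul_assoc (boltzmann G β Φ Λ _)]
  exact lintegral_normalized_lmarginal_mul _ Λ hf hb (hr₁.mul hr₂)
    (fun σ τ hστ => congrArg₂ (· * ·) (hrΛ₁ hστ) (hrΛ₂ hστ)) (lmarginal_boltzmann_ne_zero hΦ Λ)
    (lmarginal_boltzmann_ne_top hΦ Λ)

end DLR

section BoundaryLaw

instance isOpenPosMeasure_unitInterval : (volume : Measure unitInterval).IsOpenPosMeasure := by
  refine ⟨fun U hU hne hU₀ => ?_⟩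
  obtain ⟨a, b, hab, hsub⟩ := hU.exists_Ioo_subset hne
  have := measure_mono_null hsub hU₀
  rw [unitInterval.volume_Ioo, ENNReal.ofReal_eq_zero, sub_nonpos] at this
  exact this.not_gt hab

section CompactSpace

variable {E : Type*} [TopologicalSpace E] [CompactSpace E] [MeasurableSpace E]
  [OpensMeasurableSpace E] {m : Measure E} [IsFiniteMeasure m] {g : E → ℝ}

theorem integral_pos_of_continuous [Nonempty E] [m.IsOpenPosMeasure] (hg : Continuous g)
    (hpos : ∀ t, 0 < g t) : 0 < ∫ t, g t ∂m :=
  hg.integral_pos_of_hasCompactSupport_nonneg_nonzero (.of_compactSpace g) (fun t => (hpos t).le)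
    (hpos (Classical.arbitrary E)).ne'

theorem lintegral_ofReal_div_integral (hg : Continuous g) (hnonneg : ∀ t, 0 ≤ g t)
    (hint : ∫ t, g t ∂m ≠ 0) : ∫⁻ t, ENNReal.ofReal (g t / ∫ u, g u ∂m) ∂m = 1 := by
  rw [← ofReal_integral_eq_lintegral_ofReal, integral_div, div_self hint, ENNReal.ofReal_one]
  · exact (hg.div_const _).integrable_of_hasCompactSupport (.of_compactSpace _)
  · exact ae_of_all _ fun t => div_nonneg (hnonneg t) (integral_nonneg hnonneg)

end CompactSpace

/-- A homogeneous boundary law on the `(k + 1)`-regular tree: a positive continuous solution of the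
Hammerstein equation `∫ exp(-β Φ(t, u)) f(u) ^ k du = lam f(t)`. Boundary laws matter only up to
scaling, whence the constant `lam`. -/
structure IsBoundaryLaw (β : ℝ) (Φ : Sym2 unitInterval → ℝ) (k : ℕ) (f : unitInterval → ℝ)
    (lam : ℝ) : Prop where
  continuous : Continuous f
  pos : ∀ t, 0 < f t
  integral_eq : ∀ t, ∫ u, Real.exp (-β * Φ s(t, u)) * f u ^ k = lam * f t

/-- The Lebesgue density of the single-site marginals of the Gibbs measure with boundary
law `f`. -/
noncomputable def siteDensity (k : ℕ) (f : unitInterval → ℝ) (u : unitInterval) : ℝ≥0∞ :=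
  ENNReal.ofReal (f u ^ (k + 1) / ∫ v, f v ^ (k + 1))

/-- The density of the joint law of the spins at the ends of an edge, relative to independent
copies of the single-site marginal, in the Gibbs measure with boundary law `f`. -/
noncomputable def edgeDensity (β : ℝ) (Φ : Sym2 unitInterval → ℝ) (k : ℕ) (f : unitInterval → ℝ)
    (lam : ℝ) (e : Sym2 unitInterval) : ℝ≥0∞ :=
  ENNReal.ofReal ((∫ v, f v ^ (k + 1)) / lam * (Real.exp (-β * Φ e) / (e.map f).mul))

variable {β : ℝ} {Φ : Sym2 unitInterval → ℝ} {k : ℕ} {f g : unitInterval → ℝ} {lam lam' : ℝ}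

namespace IsBoundaryLaw

theorem integral_pow_pos (hf : IsBoundaryLaw β Φ k f lam) (j : ℕ) : 0 < ∫ v, f v ^ j :=
  integral_pos_of_continuous (hf.continuous.pow j) fun t => pow_pos (hf.pos t) j

theorem continuous_siteDensity (hf : IsBoundaryLaw β Φ k f lam) : Continuous (siteDensity k f) :=
  ENNReal.continuous_ofReal.comp ((hf.continuous.pow (k + 1)).div_const _)

theorem mul_map_pos (hf : IsBoundaryLaw β Φ k f lam) (e : Sym2 unitInterval) :
    0 < (e.map f).mul := by
  induction e with
  | _ a b => exact mul_pos (hf.pos a) (hf.pos b)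

theorem mul_eq_mul_of_withDensity_eq (hf : IsBoundaryLaw β Φ k f lam)
    (hg : IsBoundaryLaw β Φ k g lam')
    (h : (volume : Measure unitInterval).withDensity (siteDensity k f) =
      volume.withDensity (siteDensity k g)) (t u : unitInterval) :
    f t * g u = f u * g t := by
  have siteDensity_eq : siteDensity k f = siteDensity k g :=
    Measure.eq_of_ae_eq ((withDensity_eq_iff_of_sigmaFinite
      hf.continuous_siteDensity.aemeasurable hg.continuous_siteDensity.aemeasurable).1 h)
      hf.continuous_siteDensity hg.continuous_siteDensity
  have hZf := hf.integral_pow_pos (k + 1)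
  have hZg := hg.integral_pow_pos (k + 1)
  have pow_mul_eq (v : unitInterval) :
      f v ^ (k + 1) * ∫ w, g w ^ (k + 1) = g v ^ (k + 1) * ∫ w, f w ^ (k + 1) := by
    have := congrFun siteDensity_eq v
    rwa [siteDensity, siteDensity, ENNReal.ofReal_eq_ofReal_iff
      (div_pos (pow_pos (hf.pos v) _) hZf).le (div_pos (pow_pos (hg.pos v) _) hZg).le,
      div_eq_div_iff hZf.ne' hZg.ne'] at this
  refine (pow_left_inj₀ (mul_pos (hf.pos t) (hg.pos u)).le (mul_pos (hf.pos u) (hg.pos t)).le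
    k.add_one_ne_zero).1 (mul_right_cancel₀ hZf.ne' ?_)
  rw [mul_pow, mul_pow]
  linear_combination f u ^ (k + 1) * pow_mul_eq t - f t ^ (k + 1) * pow_mul_eq u

variable (hΦ : Continuous fun p : unitInterval × unitInterval => Φ s(p.1, p.2))
include hΦ

theorem continuous_integrand (hf : IsBoundaryLaw β Φ k f lam) (t : unitInterval) :
    Continuous fun u => Real.exp (-β * Φ s(t, u)) * f u ^ k :=
  ((hΦ.comp (Continuous.prodMk_right t)).const_mul _).rexp.mul (hf.continuous.pow k)

theorem lam_pos (hf : IsBoundaryLaw β Φ k f lam) : 0 < lam := by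
  have hint := integral_pos_of_continuous (m := volume) (hf.continuous_integrand hΦ 0)
    fun u => mul_pos (Real.exp_pos _) (pow_pos (hf.pos u) k)
  rw [hf.integral_eq 0] at hint
  exact pos_of_mul_pos_left hint (hf.pos 0).le

theorem isMarkovDensity (hf : IsBoundaryLaw β Φ k f lam) :
    IsMarkovDensity volume (siteDensity k f) (edgeDensity β Φ k f lam) where
  measurable_site := hf.continuous_siteDensity.measurable
  measurable_edge :=
    (((hΦ.const_mul _).rexp.measurable.div ((hf.continuous.comp continuous_fst).mul
      (hf.continuous.comp continuous_snd)).measurable).const_mul _).ennreal_ofReal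
  lintegral_site := lintegral_ofReal_div_integral (hf.continuous.pow (k + 1))
    (fun t => (pow_pos (hf.pos t) _).le) (hf.integral_pow_pos (k + 1)).ne'
  lintegral_transition t := by
    have transition_eq (u : unitInterval) :
        siteDensity k f u * edgeDensity β Φ k f lam s(t, u) =
          ENNReal.ofReal (Real.exp (-β * Φ s(t, u)) * f u ^ k /
            ∫ v, Real.exp (-β * Φ s(t, v)) * f v ^ k) := by
      have hZ := hf.integral_pow_pos (k + 1)
      have ht := (hf.pos t).ne'
      have hu := (hf.pos u).ne'
      rw [siteDensity, edgeDensity,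
        ← ENNReal.ofReal_mul (div_pos (pow_pos (hf.pos u) _) hZ).le, hf.integral_eq, Sym2.map_mk,
        Sym2.mul_mk]
      congr 1
      field_simp
      ring
    simp only [transition_eq]
    refine lintegral_ofReal_div_integral (hf.continuous_integrand hΦ t)
      (fun u => (mul_pos (Real.exp_pos _) (pow_pos (hf.pos u) k)).le) ?_
    rw [hf.integral_eq t]
    exact (mul_pos (hf.lam_pos hΦ) (hf.pos t)).ne'

variable {V : Type*} [DecidableEq V] {G : SimpleGraph V} [G.LocallyFinite]

theorem exists_prod_density_eq_boltzmann_mul (hf : IsBoundaryLaw β Φ k f lam)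
    (hdeg : G.IsRegularOfDegree (k + 1)) (Λ : Finset V) :
    ∃ r : (V → unitInterval) → ℝ≥0∞, Measurable r ∧ DependsOn r (Λ : Set V)ᶜ ∧
      ∀ σ, (∏ x ∈ Λ, siteDensity k f (σ x)) *
        ∏ e ∈ edgesMeeting G Λ, edgeDensity β Φ k f lam (e.map σ) =
          boltzmann G β Φ Λ σ * r σ := by
  have hZ := hf.integral_pow_pos (k + 1)
  have hlam := hf.lam_pos hΦ
  have prod_mul_map (σ : V → unitInterval) :
      ∏ e ∈ edgesMeeting G Λ, ((e.map σ).map f).mul = (∏ x ∈ Λ, f (σ x) ^ (k + 1)) *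
        ∏ e ∈ edgesMeeting G Λ, ∏ v ∈ e.toFinset with v ∉ Λ, f (σ v) := by
    simp only [Sym2.map_map, prod_mul_edgesMeeting, hdeg.degree_eq, Function.comp_apply]
  set Z := ∫ v, f v ^ (k + 1) with hZdef
  refine ⟨fun σ => ENNReal.ofReal ((Z / lam) ^ (edgesMeeting G Λ).card / (Z ^ Λ.card *
    ∏ e ∈ edgesMeeting G Λ, ∏ v ∈ e.toFinset with v ∉ Λ, f (σ v))), ?_, ?_, fun σ => ?_⟩
  · have := hf.continuous.measurable
    fun_prop
  · refine fun σ τ hστ => ?_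
    simp only
    congr! 6 with e - v hv
    exact hστ v (Finset.mem_filter.1 hv).2
  have hsite (x : V) : 0 < f (σ x) ^ (k + 1) := pow_pos (hf.pos _) _
  simp only [siteDensity, edgeDensity, boltzmann, ← hZdef]
  rw [← ENNReal.ofReal_prod_of_nonneg fun x _ => (div_pos (hsite x) hZ).le,
    ← ENNReal.ofReal_prod_of_nonneg fun e _ => (mul_pos (div_pos hZ hlam)
      (div_pos (Real.exp_pos _) (hf.mul_map_pos _))).le,
    ← ENNReal.ofReal_mul (Finset.prod_nonneg fun x _ => (div_pos (hsite x) hZ).le),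
    ← ENNReal.ofReal_mul (Real.exp_pos _).le, energy, Finset.mul_sum, Real.exp_sum]
  congr 1
  simp only [Finset.prod_mul_distrib, Finset.prod_div_distrib, Finset.prod_const, prod_mul_map,
    div_pow]
  have hprod := (Finset.prod_pos fun x (_ : x ∈ Λ) => hsite x).ne'
  field_simp

theorem exists_isGibbsMeasure (hf : IsBoundaryLaw β Φ k f lam) (hG : G.IsTree)
    (hdeg : G.IsRegularOfDegree (k + 1)) :
    ∃ μ : Measure (V → unitInterval), IsGibbsMeasure G β Φ μ ∧ IsTranslationInvariant G μ ∧
      ∀ x, μ.map (Function.eval x) = volume.withDensity (siteDensity k f) := by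
  have h := hf.isMarkovDensity hΦ
  obtain ⟨μ, hμ, hchain⟩ := exists_isTreeChain hG h
  exact ⟨μ, hchain.isGibbsMeasure hΦ h hG.connected
      (hf.exists_prod_density_eq_boltzmann_mul hΦ hdeg),
    fun g => (hchain.map_iso h g).unique hG.connected hchain, hchain.map_eval h⟩

theorem exists_ne_isGibbsMeasure (hf : IsBoundaryLaw β Φ k f lam)
    (hg : IsBoundaryLaw β Φ k g lam') (hne : ∃ t u, f t * g u ≠ f u * g t) (hG : G.IsTree)
    (hdeg : G.IsRegularOfDegree (k + 1)) :
    ∃ μ₁ μ₂ : Measure (V → unitInterval), μ₁ ≠ μ₂ ∧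
      IsGibbsMeasure G β Φ μ₁ ∧ IsTranslationInvariant G μ₁ ∧
      IsGibbsMeasure G β Φ μ₂ ∧ IsTranslationInvariant G μ₂ := by
  obtain ⟨μ₁, hμ₁, hinv₁, hmarg₁⟩ := hf.exists_isGibbsMeasure hΦ hG hdeg
  obtain ⟨μ₂, hμ₂, hinv₂, hmarg₂⟩ := hg.exists_isGibbsMeasure hΦ hG hdeg
  refine ⟨μ₁, μ₂, fun heq => ?_, hμ₁, hinv₁, hμ₂, hinv₂⟩
  obtain ⟨t, u, htu⟩ := hne
  obtain ⟨o⟩ := hG.connected.nonempty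
  exact htu (hf.mul_eq_mul_of_withDensity_eq hg
    ((hmarg₁ o).symm.trans (heq ▸ hmarg₂ o)) t u)

end IsBoundaryLaw

end BoundaryLaw

section AffineBoundaryLaw

theorem integral_unitInterval (φ : ℝ → ℝ) :
    ∫ u : unitInterval, φ u = ∫ x in (0 : ℝ)..1, φ x := by
  rw [intervalIntegral.integral_of_le zero_le_one, ← integral_Icc_eq_integral_Ioc]
  exact integral_subtype measurableSet_Icc φ

theorem abs_sub_half_le {x : ℝ} (hx : x ∈ unitInterval) : |x - 1 / 2| ≤ 1 / 2 :=
  abs_le.2 ⟨by linarith [hx.1], by linarith [hx.2]⟩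

theorem one_add_mul_sub_half_pos {c x : ℝ} (hc : |c| < 2) (hx : x ∈ unitInterval) :
    0 < 1 + c * (x - 1 / 2) := by
  have h : |c * (x - 1 / 2)| < 1 := by
    rw [abs_mul]
    linarith [mul_le_mul_of_nonneg_left (abs_sub_half_le hx) (abs_nonneg c)]
  linarith [(abs_lt.1 h).1]

theorem mul_integral_affine_pow (c : ℝ) (j : ℕ) :
    c * ∫ x in (0 : ℝ)..1, (1 + c * (x - 1 / 2)) ^ j =
      ((1 + c / 2) ^ (j + 1) - (1 - c / 2) ^ (j + 1)) / (j + 1) := by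
  have affine_eq (x : ℝ) : 1 + c * (x - 1 / 2) = c * x + (1 - c / 2) := by ring
  simp only [affine_eq]
  rw [intervalIntegral.mul_integral_comp_mul_add (f := fun y => y ^ j), integral_pow]
  ring

theorem mul_integral_centered_affine_pow (c : ℝ) (j : ℕ) :
    c * ∫ x in (0 : ℝ)..1, (x - 1 / 2) * (1 + c * (x - 1 / 2)) ^ j =
      (∫ x in (0 : ℝ)..1, (1 + c * (x - 1 / 2)) ^ (j + 1)) -
        ∫ x in (0 : ℝ)..1, (1 + c * (x - 1 / 2)) ^ j := by
  rw [← intervalIntegral.integral_const_mul, ← intervalIntegral.integral_sub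
    (Continuous.intervalIntegrable (by fun_prop) _ _)
    (Continuous.intervalIntegrable (by fun_prop) _ _)]
  refine intervalIntegral.integral_congr fun x _ => ?_
  ring

theorem sq_mul_integral_centered_affine_pow (c : ℝ) (j : ℕ) :
    c ^ 2 * ∫ x in (0 : ℝ)..1, (x - 1 / 2) * (1 + c * (x - 1 / 2)) ^ j =
      ((1 + c / 2) ^ (j + 2) - (1 - c / 2) ^ (j + 2)) / (j + 2) -
        c * ∫ x in (0 : ℝ)..1, (1 + c * (x - 1 / 2)) ^ j := by
  have h := mul_integral_affine_pow c (j + 1)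
  rw [Nat.cast_add_one, add_assoc (j : ℝ), one_add_one_eq_two] at h
  rw [sq, mul_assoc, mul_integral_centered_affine_pow, mul_sub, h]

theorem self_lt_self_mul_one_add_pow {y : ℝ} (hy : -1 ≤ y) (hy₀ : y ≠ 0) {j : ℕ} (hj : j ≠ 0) :
    y < y * (1 + y) ^ j := by
  rcases hy₀.lt_or_gt with h | h
  · exact lt_mul_of_lt_one_right h (pow_lt_one₀ (by linarith) (by linarith) hj)
  · exact lt_mul_of_one_lt_right h (one_lt_pow₀ (by linarith) hj)

theorem mul_integral_centered_affine_pow_pos {c : ℝ} (hc₀ : c ≠ 0) (hc : |c| < 2) {j : ℕ}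
    (hj : j ≠ 0) : 0 < c * ∫ x in (0 : ℝ)..1, (x - 1 / 2) * (1 + c * (x - 1 / 2)) ^ j := by
  have integral_sub_half : ∫ x in (0 : ℝ)..1, c * (x - 1 / 2) = 0 := by
    rw [intervalIntegral.integral_const_mul]
    norm_num
  rw [← intervalIntegral.integral_const_mul]
  simp only [← mul_assoc c]
  refine integral_sub_half.symm.trans_lt ?_
  have hlt (x : ℝ) (hx : x ∈ unitInterval) (hx₀ : x - 1 / 2 ≠ 0) :
      c * (x - 1 / 2) < c * (x - 1 / 2) * (1 + c * (x - 1 / 2)) ^ j :=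
    self_lt_self_mul_one_add_pow (by linarith [one_add_mul_sub_half_pos hc hx])
      (mul_ne_zero hc₀ hx₀) hj
  refine intervalIntegral.integral_lt_integral_of_continuousOn_of_le_of_exists_lt zero_lt_one
    ?_ ?_ (fun x hx => ?_) ⟨1, by simp, ?_⟩
  · fun_prop
  · fun_prop
  · rcases eq_or_ne (x - 1 / 2) 0 with h | h
    · simp only [h, mul_zero, zero_mul, le_refl]
    · exact (hlt x ⟨hx.1.le, hx.2⟩ h).le
  · exact hlt 1 (by simp) (by norm_num)

theorem kernel_pos {γ : ℝ} (hγ : |γ| < 4) (t u : unitInterval) : 0 < kernel γ t u := by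
  refine one_add_mul_sub_half_pos ?_ u.2
  rw [abs_mul]
  linarith [mul_le_mul_of_nonneg_left (abs_sub_half_le t.2) (abs_nonneg γ)]

theorem interaction_mk (β γ : ℝ) (t u : unitInterval) :
    interaction β γ s(t, u) = -(1 / β) * Real.log (kernel γ t u) :=
  rfl

theorem exp_neg_mul_interaction {β γ : ℝ} (hβ : β ≠ 0) (hγ : |γ| < 4) (t u : unitInterval) :
    Real.exp (-β * interaction β γ s(t, u)) = kernel γ t u := by
  rw [interaction_mk, ← mul_assoc, neg_mul_neg, mul_one_div_cancel hβ, one_mul,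
    Real.exp_log (kernel_pos hγ t u)]

theorem continuous_interaction (β : ℝ) {γ : ℝ} (hγ : |γ| < 4) :
    Continuous fun p : unitInterval × unitInterval => interaction β γ s(p.1, p.2) := by
  simp only [interaction_mk]
  refine continuous_const.mul (Continuous.log ?_ fun p => (kernel_pos hγ _ _).ne')
  unfold kernel
  fun_prop

theorem integral_kernel_mul_affine_pow (γ c : ℝ) (k : ℕ) (t : ℝ) :
    ∫ x in (0 : ℝ)..1, kernel γ t x * (1 + c * (x - 1 / 2)) ^ k =
      (∫ x in (0 : ℝ)..1, (1 + c * (x - 1 / 2)) ^ k) +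
        γ * (t - 1 / 2) * ∫ x in (0 : ℝ)..1, (x - 1 / 2) * (1 + c * (x - 1 / 2)) ^ k := by
  rw [← intervalIntegral.integral_const_mul, ← intervalIntegral.integral_add
    (Continuous.intervalIntegrable (by fun_prop) _ _)
    (Continuous.intervalIntegrable (by fun_prop) _ _)]
  refine intervalIntegral.integral_congr fun x _ => ?_
  simp only [kernel]
  ring

theorem isBoundaryLaw_affine {β γ c : ℝ} {k : ℕ} (hβ : β ≠ 0) (hγ : |γ| < 4) (hc : |c| < 2)
    (hslope : γ * (∫ x in (0 : ℝ)..1, (x - 1 / 2) * (1 + c * (x - 1 / 2)) ^ k) =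
      c * ∫ x in (0 : ℝ)..1, (1 + c * (x - 1 / 2)) ^ k) :
    IsBoundaryLaw β (interaction β γ) k (fun t => 1 + c * ((t : ℝ) - 1 / 2))
      (∫ x in (0 : ℝ)..1, (1 + c * (x - 1 / 2)) ^ k) where
  continuous := by fun_prop
  pos t := one_add_mul_sub_half_pos hc t.2
  integral_eq t := by
    simp only [exp_neg_mul_interaction hβ hγ]
    rw [integral_unitInterval fun x => kernel γ t x * (1 + c * (x - 1 / 2)) ^ k,
      integral_kernel_mul_affine_pow]
    linear_combination ((t : ℝ) - 1 / 2) * hslope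

theorem isBoundaryLaw_one {β γ : ℝ} {k : ℕ} (hβ : β ≠ 0) (hγ : |γ| < 4) :
    IsBoundaryLaw β (interaction β γ) k 1 1 := by
  have h := isBoundaryLaw_affine (c := 0) (k := k) hβ hγ (by norm_num) (by norm_num)
  simpa [Pi.one_def] using h

theorem mul_integral_affine_pow_of_root {k n : ℕ} {x : ℝ} (hroot : P k n x = Q k n x) :
    x ^ (n - 1) * ∫ y in (0 : ℝ)..1, (1 + x ^ (n - 1) * (y - 1 / 2)) ^ k = x ^ (n - k) := by
  rw [mul_integral_affine_pow, ← P, hroot, Q]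
  field_simp

theorem C_mul_integral_eq {k n : ℕ} (hk : 1 ≤ k) (hkn : k < n) {x : ℝ}
    (hx : x ∈ Set.Ioo (0 : ℝ) 1) (hroot : P k n x = Q k n x) :
    C k n x * (∫ y in (0 : ℝ)..1, (y - 1 / 2) * (1 + x ^ (n - 1) * (y - 1 / 2)) ^ k) =
      x ^ (n - 1) * ∫ y in (0 : ℝ)..1, (1 + x ^ (n - 1) * (y - 1 / 2)) ^ k := by
  have hc₀ : 0 < x ^ (n - 1) := pow_pos hx.1 _
  have hc₁ : x ^ (n - 1) < 1 := pow_lt_one₀ hx.1.le hx.2 (by omega)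
  have hmoment := mul_integral_centered_affine_pow_pos (j := k) hc₀.ne'
    (by rw [abs_of_pos hc₀]; linarith) (by omega)
  have pow_split : x ^ (3 * n - k - 2) = (x ^ (n - 1)) ^ 2 * x ^ (n - k) := by
    rw [← pow_mul, ← pow_add]
    congr 1
    omega
  have denominator_eq :
      1 / (2 + (k : ℝ)) * ((1 + x ^ (n - 1) / 2) ^ (k + 2) - (1 - x ^ (n - 1) / 2) ^ (k + 2)) -
          x ^ (n - k) = (x ^ (n - 1)) ^ 2 *
        ∫ y in (0 : ℝ)..1, (y - 1 / 2) * (1 + x ^ (n - 1) * (y - 1 / 2)) ^ k := by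
    rw [sq_mul_integral_centered_affine_pow, mul_integral_affine_pow_of_root hroot]
    ring
  rw [C, denominator_eq, pow_split, mul_integral_affine_pow_of_root hroot,
    mul_div_mul_left _ _ (pow_ne_zero 2 hc₀.ne'),
    div_mul_cancel₀ _ (pos_of_mul_pos_right hmoment hc₀.le).ne']

end AffineBoundaryLaw

end CayleyGibbs

theorem theorem5p9_general {V : Type*} [DecidableEq V] {G : SimpleGraph V} [G.LocallyFinite]
    {k n : ℕ} (hk : 1 ≤ k) (hkn : k < n) (hG : G.IsTree) (hdeg : G.IsRegularOfDegree (k + 1))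
    {x : ℝ} (hx : x ∈ Set.Ioo (0 : ℝ) 1) (hroot : CayleyGibbs.P k n x = CayleyGibbs.Q k n x)
    (hC : |CayleyGibbs.C k n x| < 4) {β : ℝ} (hβ : β ≠ 0) :
    ∃ μ₁ μ₂ : Measure (V → unitInterval), μ₁ ≠ μ₂ ∧
      CayleyGibbs.IsGibbsMeasure G β (CayleyGibbs.interaction β (CayleyGibbs.C k n x)) μ₁ ∧
      CayleyGibbs.IsTranslationInvariant G μ₁ ∧
      CayleyGibbs.IsGibbsMeasure G β (CayleyGibbs.interaction β (CayleyGibbs.C k n x)) μ₂ ∧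
      CayleyGibbs.IsTranslationInvariant G μ₂ := by
  have slope_pos : 0 < x ^ (n - 1) := pow_pos hx.1 _
  have slope_lt_one : x ^ (n - 1) < 1 := pow_lt_one₀ hx.1.le hx.2 (by omega)
  have constant_law := CayleyGibbs.isBoundaryLaw_one (k := k) hβ hC
  have affine_law := CayleyGibbs.isBoundaryLaw_affine hβ hC
    (by rw [abs_of_pos slope_pos]; linarith) (CayleyGibbs.C_mul_integral_eq hk hkn hx hroot)
  refine constant_law.exists_ne_isGibbsMeasure (CayleyGibbs.continuous_interaction β hC)
    affine_law ⟨0, 1, ?_⟩ hG hdeg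
  simp only [Pi.one_apply, one_mul, Set.Icc.coe_zero, Set.Icc.coe_one]
  linarith

theorem theorem5p9 {V : Type*} [DecidableEq V] (G : SimpleGraph V) [G.LocallyFinite]
    (k : ℕ) (hk : 4 ≤ k) (hG : G.IsTree) (hdeg : G.IsRegularOfDegree (k + 1))
    (ξ : ℕ → ℝ) (hξ : CayleyGibbs.IsRootSequence k ξ)
    (n : ℕ → ℕ) (hn : CayleyGibbs.IsLimsupSubsequence k ξ n)
    (p : ℕ) (hp : p ∈ CayleyGibbs.N0 k ξ n)
    (β : ℝ) (hβ : 0 < β) :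
    ∃ μ₁ μ₂ : MeasureTheory.Measure (V → unitInterval),
      μ₁ ≠ μ₂ ∧
      CayleyGibbs.IsGibbsMeasure G β
        (CayleyGibbs.interaction β (CayleyGibbs.gam k ξ n p)) μ₁ ∧
      CayleyGibbs.IsTranslationInvariant G μ₁ ∧
      CayleyGibbs.IsGibbsMeasure G β
        (CayleyGibbs.interaction β (CayleyGibbs.gam k ξ n p)) μ₂ ∧
      CayleyGibbs.IsTranslationInvariant G μ₂ := by
  obtain ⟨hx, hroot⟩ := hξ (n p) (hn.gt p)
  exact theorem5p9_general (by omega) (hn.gt p) hG hdeg hx hroot hp hβ.ne'
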